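/- **Theorem 4.5.** Let $\mathbb K\in\{\mathbb R,\mathbb C\}$ and let $w$ be the space of all sequences $x=(x_k)_{k\ge 0}$ in $\mathbb K$. Let $p=(p_k)_{k\ge0}$ be a bounded sequence of strictly positive reals, and put $$l(p)=\{x:\textstyle\sum_k|x_k|^{p_k}<\infty\},\quad c_0(p)=\{x:|x_k|^{p_k}\to0\},\quad c(p)=\{x:\exists\, l\in\mathbb K,\ |x_k-l|^{p_k}\to0\},\quad l_\infty(p)=\{x:\sup_k|x_k|^{p_k}<\infty\}.$$ Let $r,s,t\in w$ with $r_n\neq0$ and $t_n\ne0$ for all $n$ and $s_0\neq 0$, and let $u,v\in\mathbb K\setminus\{0\}$. Let $A(r,s,t)$ be the matrix with entries $s_{n-k}t_k/r_n$ for $0\le k\le n$ and $0$ for $k>n$, let $B=B(u,v)$ be the matrix with $u$ on the diagonal, $v$ on the first subdiagonal and $0$ elsewhere, and put $A(r,s,t;B)=A(r,s,t)\cdot B$. For $X\in\{l(p),c_0(p),c(p),l_\infty(p)\}$ let $$X(r,s,t,p;B)=\{x\in w: A(r,s,t;B)x\in X\},$$ written $l(r,s,t,p;B)$, $c_0(r,s,t,p;B)$,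 $c(r,s,t,p;B)$, $l_\infty(r,s,t,p;B)$ respectively. The $\gamma$-dual of $U\subseteq w$ is $$U^\gamma=\Big\{a\in w:\ \sup_n\Big|\sum_{k=0}^n a_kx_k\Big|<\infty\ \text{ for all } x\in U\Big\}.$$ For $n\ge0$ let $D_n^{(s)}=s_0^{-(n+1)}\det(d_{ij})_{1\le i,j\le n}$, where $d_{ij}=s_{i-j+1}$ if $j\le i+1$ and $d_{ij}=0$ otherwise (so $D_0^{(s)}=1/s_0$). For $a\in w$ define $E=(e_{nk})$ by $e_{nk}=0$ for $k>n$ and, for $0\le k\le n$, $$e_{nk}=r_k\Big[\frac1u\frac{a_k}{s_0t_k}+\sum_{j=k}^{k+1}(-1)^{j-k}\frac{D^{(s)}_{j-k}}{t_j}\sum_{l=k+1}^n\frac{(-v)^{l-j}}{u^{l-j+1}}a_l+\sum_{j=k+2}^{n}(-1)^{j-k}\frac{D^{(s)}_{j-k}}{t_j}\sum_{l=j}^n\frac{(-v)^{l-j}}{u^{l-j+1}}a_l\Big],$$ empty sums being $0$. With $L$ ranging over the positive integers, let $$\Gamma_1(p)=\Big\{a:\exists L,\ \sup_n\sum_k|e_{nk}|L^{-1/p_k}<\infty\Big\},\qquad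 \Gamma_2(p)=\Big\{a:\sup_n\Big|\sum_k e_{nk}\Big|<\infty\Big\},$$ $$\Gamma_3(p)=\Big\{a:\forall L,\ \sup_n\sum_k|e_{nk}|L^{1/p_k}<\infty\Big\},\qquad \Gamma_4(p)=\Big\{a:\exists L,\ \sup_n\sup_k|e_{nk}L^{-1}|^{p_k}<\infty\Big\},$$ and, when $p_k>1$ for all $k$, with $p_k'=p_k/(p_k-1)$, $$\Gamma_5(p)=\Big\{a:\exists L,\ \sup_n\sum_k|e_{nk}L^{-1}|^{p_k'}<\infty\Big\}.$$ Then: (a) If $p_k>1$ for all $k$, then $[l(r,s,t,p;B)]^\gamma=\Gamma_5(p)$; if $0<p_k\le1$ for all $k$, then $[l(r,s,t,p;B)]^\gamma=\Gamma_4(p)$. (b) In general (that is, for $0<p_k\le \sup_j p_j<\infty$), (i) $[c_0(r,s,t,p;B)]^\gamma=\Gamma_1(p)$, (ii) $[c(r,s,t,p;B)]^\gamma=\Gamma_1(p)\cap\Gamma_2(p)$, (iii) $[l_\infty(r,s,t,p;B)]^\gamma=\Gamma_3(p)$. -/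

import Mathlib

open Finset Filter Topology
open scoped ENNReal

namespace GenMeans

/-! Scalar sequences are functions `ℕ → 𝕜` (indexed from `0`), `𝕜` being `ℝ` or `ℂ`;
infinite matrices are functions `ℕ → ℕ → 𝕜`, row index first. -/

section MaddoxSpaces

variable {𝕜 : Type*} [RCLike 𝕜]

/-- `l(p)`: the sequences with `∑ₖ |xₖ| ^ pₖ < ∞`. -/
def maddoxL (p : ℕ → ℝ) : Set (ℕ → 𝕜) :=
  {x | Summable fun k => ‖x k‖ ^ p k}

/-- `c₀(p)`: the sequences with `|xₖ| ^ pₖ → 0`. -/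
def maddoxC0 (p : ℕ → ℝ) : Set (ℕ → 𝕜) :=
  {x | Tendsto (fun k => ‖x k‖ ^ p k) atTop (𝓝 0)}

/-- `c(p)`: the sequences with `|xₖ - l| ^ pₖ → 0` for some scalar `l`. -/
def maddoxC (p : ℕ → ℝ) : Set (ℕ → 𝕜) :=
  {x | ∃ l : 𝕜, Tendsto (fun k => ‖x k - l‖ ^ p k) atTop (𝓝 0)}

/-- `l_∞(p)`: the sequences with `supₖ |xₖ| ^ pₖ < ∞`. -/
def maddoxLInfty (p : ℕ → ℝ) : Set (ℕ → 𝕜) :=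
  {x | BddAbove (Set.range fun k => ‖x k‖ ^ p k)}

/-- `bs`: the sequences whose series has bounded partial sums. -/
def bs : Set (ℕ → 𝕜) :=
  {x | BddAbove (Set.range fun n => ‖∑ k ∈ range (n + 1), x k‖)}

/-- The multiplier space `M(U, V)`. -/
def multiplier (U V : Set (ℕ → 𝕜)) : Set (ℕ → 𝕜) :=
  {a | ∀ x ∈ U, (fun k => a k * x k) ∈ V}

/-- The `γ`-dual `U^γ = M(U, bs)`. -/
def gammaDual (U : Set (ℕ → 𝕜)) : Set (ℕ → 𝕜) :=
  multiplier U bs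

end MaddoxSpaces

section Matrices

variable {𝕜 : Type*} [RCLike 𝕜]

/-- The matrix `A(r, s, t)` of generalized means. -/
def meanMatrix (r s t : ℕ → 𝕜) (n k : ℕ) : 𝕜 :=
  if k ≤ n then s (n - k) * t k / r n else 0

/-- The double-band matrix `B(u, v)`: `u` on the diagonal, `v` just below it. -/
def bandMatrix (u v : 𝕜) (n k : ℕ) : 𝕜 :=
  if k = n then u else if k + 1 = n then v else 0

/-- The product `S T` of two infinite matrices with `S` lower triangular
(the terms with `j > n` vanish). -/
def triangleMul (S T : ℕ → ℕ → 𝕜) (n k : ℕ) : 𝕜 :=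
  ∑ j ∈ range (n + 1), S n j * T j k

/-- The transform `T x` of a sequence by a lower triangular matrix
(the terms with `k > n` vanish). -/
def triangleTransform (T : ℕ → ℕ → 𝕜) (x : ℕ → 𝕜) (n : ℕ) : 𝕜 :=
  ∑ k ∈ range (n + 1), T n k * x k

/-- The triangle `A(r, s, t; B) = A(r, s, t) · B(u, v)`. -/
def meanBandMatrix (r s t : ℕ → 𝕜) (u v : 𝕜) : ℕ → ℕ → 𝕜 :=
  triangleMul (meanMatrix r s t) (bandMatrix u v)

/-- `X(r, s, t, p; B)`, the matrix domain of `A(r, s, t; B)` in the sequence space `X`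
(where `p` enters through `X`). -/
def meanBandSpace (r s t : ℕ → 𝕜) (u v : 𝕜) (X : Set (ℕ → 𝕜)) : Set (ℕ → 𝕜) :=
  {x | triangleTransform (meanBandMatrix r s t u v) x ∈ X}

/-- The numbers `Dₙ^{(s)}`: `s₀ ^ {-(n+1)}` times the determinant of the `n × n` matrix with
entries `s_{i+1-j}` for `j ≤ i + 1` and `0` elsewhere; in particular `D₀^{(s)} = 1 / s₀`. -/
noncomputable def dCoeff (s : ℕ → 𝕜) (n : ℕ) : 𝕜 :=
  1 / s 0 ^ (n + 1) * Matrix.det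
    (Matrix.of fun i j : Fin n =>
      if (j : ℕ) ≤ (i : ℕ) + 1 then s ((i : ℕ) + 1 - (j : ℕ)) else 0)

/-- The matrix `E = (e_{nk})` attached to the sequence `a`. All the natural-number subtractions
in it are exact. -/
noncomputable def eMatrix (r s t : ℕ → 𝕜) (u v : 𝕜) (a : ℕ → 𝕜) (n k : ℕ) : 𝕜 :=
  if k ≤ n then
    r k * (1 / u * (a k / (s 0 * t k))
      + ∑ j ∈ Icc k (k + 1), (-1) ^ (j - k) * (dCoeff s (j - k) / t j)
          * ∑ l ∈ Icc (k + 1) n, (-v) ^ (l - j) / u ^ (l - j + 1) * a l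
      + ∑ j ∈ Icc (k + 2) n, (-1) ^ (j - k) * (dCoeff s (j - k) / t j)
          * ∑ l ∈ Icc j n, (-v) ^ (l - j) / u ^ (l - j + 1) * a l)
  else 0

end Matrices

section GammaSets

variable {𝕜 : Type*} [RCLike 𝕜]

/-! Sums and suprema of nonnegative terms are taken in `[0, ∞]`. -/

/-- `Γ₁(p)`. -/
noncomputable def Gamma1 (r s t : ℕ → 𝕜) (u v : 𝕜) (p : ℕ → ℝ) : Set (ℕ → 𝕜) :=
  {a | ∃ L : ℕ, 1 ≤ L ∧
    (⨆ n, ∑' k, ENNReal.ofReal (‖eMatrix r s t u v a n k‖ * (L : ℝ) ^ (-(1 / p k)))) < ⊤}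

/-- `Γ₂(p)`. The sum over `k` is finite, since `e_{nk} = 0` for `k > n`. -/
noncomputable def Gamma2 (r s t : ℕ → 𝕜) (u v : 𝕜) : Set (ℕ → 𝕜) :=
  {a | (⨆ n, ‖∑' k, eMatrix r s t u v a n k‖ₑ) < ⊤}

/-- `Γ₃(p)`. -/
noncomputable def Gamma3 (r s t : ℕ → 𝕜) (u v : 𝕜) (p : ℕ → ℝ) : Set (ℕ → 𝕜) :=
  {a | ∀ L : ℕ, 1 ≤ L →
    (⨆ n, ∑' k, ENNReal.ofReal (‖eMatrix r s t u v a n k‖ * (L : ℝ) ^ (1 / p k))) < ⊤}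

/-- `Γ₄(p)`. -/
noncomputable def Gamma4 (r s t : ℕ → 𝕜) (u v : 𝕜) (p : ℕ → ℝ) : Set (ℕ → 𝕜) :=
  {a | ∃ L : ℕ, 1 ≤ L ∧
    (⨆ n, ⨆ k, ENNReal.ofReal (‖eMatrix r s t u v a n k * (L : 𝕜)⁻¹‖ ^ p k)) < ⊤}

/-- `Γ₅(p)`, with the conjugate exponents `pₖ' = pₖ / (pₖ - 1)` (used when all `pₖ > 1`). -/
noncomputable def Gamma5 (r s t : ℕ → 𝕜) (u v : 𝕜) (p : ℕ → ℝ) : Set (ℕ → 𝕜) :=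
  {a | ∃ L : ℕ, 1 ≤ L ∧
    (⨆ n, ∑' k, ENNReal.ofReal
      (‖eMatrix r s t u v a n k * (L : 𝕜)⁻¹‖ ^ (p k / (p k - 1)))) < ⊤}

end GammaSets

end GenMeans

/-! Apart from the diagonal factors `1/r` and `t`, the triangle `A(r,s,t;B)` is a product of two
Toeplitz triangles, with generating functions `∑ sₙ Xⁿ` and `u + vX`. Both are units among the
formal power series; their inverses have coefficients `(-1)ⁿ Dₙ` and `(-v)ⁿ/uⁿ⁺¹`. Hence `x ↦ y =
A(r,s,t;B) x` is a bijection of `w`. Writing `x` in terms of `y` in `∑_{l≤n} a_l x_l` and exchanging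
sums gives `∑ₖ e_{nk} yₖ`, so the `γ`-dual consists of the `a` for which `E` maps `X` into the
bounded sequences (`mem_gammaDual_meanBandSpace_iff`).

What remains concerns an arbitrary lower triangular `T` on the four Maddox spaces. Sufficiency is a
termwise estimate, by Young's inequality when `pₖ > 1`. Necessity is a gliding hump
(`exists_not_bddAbove_triangleTransform`): if the condition fails, bounded columns force arbitrarily
large weighted row sums beyond every index, and these are glued into one `y ∈ X` with `T y`
unbounded. Only the choice of weights depends on the space. -/

namespace GenMeans

/-! ### Inversion of the triangle by power series; reduction of the duals to the matrix `E` -/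

section Inverse

variable {𝕜 : Type*} [RCLike 𝕜]

/-- Cramer's rule for the lower triangular Toeplitz matrix of `s`: the coefficients of the
inverse power series of `∑ sₙ Xⁿ` are `(-1)ⁿ Dₙ`. -/
theorem eq_dCoeff_of_mul_eq_one {s c : ℕ → 𝕜} (hs : s 0 ≠ 0)
    (h : PowerSeries.mk s * PowerSeries.mk c = 1) (n : ℕ) :
    c n = (-1) ^ n * dCoeff s n := by
  let T : Matrix (Fin (n + 1)) (Fin (n + 1)) 𝕜 :=
    Matrix.of fun i j => if (j : ℕ) ≤ (i : ℕ) then s ((i : ℕ) - (j : ℕ)) else 0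
  have hdet : T.det = s 0 ^ (n + 1) := by
    rw [Matrix.det_of_isLowerTriangular]
    · simp [T]
    · intro i j hij
      have hij' : ¬ (j : ℕ) ≤ (i : ℕ) := not_le.2 (by simpa using hij)
      exact if_neg hij'
  have hTc : T.mulVec (fun i => c i) = Pi.single 0 1 := by
    ext i
    have hi := congrArg (PowerSeries.coeff (i : ℕ)) h
    rw [mul_comm, PowerSeries.coeff_mul, Nat.sum_antidiagonal_eq_sum_range_succ_mk,
      PowerSeries.coeff_one] at hi
    simp only [PowerSeries.coeff_mk] at hi
    have e : T.mulVec (fun i => c i) i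
        = ∑ j ∈ range (n + 1), (if j ≤ (i : ℕ) then s ((i : ℕ) - j) else 0) * c j := by
      rw [Finset.sum_range]; rfl
    rw [e, ← Finset.sum_subset (Finset.range_mono (Nat.succ_le_succ (Nat.lt_succ_iff.1 i.2)))]
    · calc _ = ∑ j ∈ range ((i : ℕ) + 1), c j * s ((i : ℕ) - j) := by
            refine Finset.sum_congr rfl fun j hj => ?_
            rw [if_pos (Nat.lt_succ_iff.1 (Finset.mem_range.1 hj)), mul_comm]
        _ = _ := by
            rw [hi]
            by_cases h0 : i = 0
            · simp [h0]
            · have : (i : ℕ) ≠ 0 := fun h' => h0 (Fin.ext h')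
              simp [h0, this]
    · intro j _ hj
      rw [if_neg (by simpa using hj), zero_mul]
  have key : T.det * c n = T.adjugate (Fin.last n) 0 := by
    have h1 : T.adjugate.mulVec (T.mulVec fun i => c i) = T.det • fun i : Fin (n + 1) => c i := by
      rw [Matrix.mulVec_mulVec, Matrix.adjugate_mul, Matrix.smul_mulVec, Matrix.one_mulVec]
    rw [hTc] at h1
    have h2 := congrFun h1 (Fin.last n)
    simp at h2
    rw [← h2]
  -- Deleting row `0` and the last column of `T` raises the row index by one and leaves the
  -- Hessenberg matrix of `dCoeff`; the cofactor sign is `(-1)ⁿ`.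
  rw [Matrix.adjugate_fin_succ_eq_det_submatrix, hdet] at key
  have hsub : T.submatrix (Fin.succAbove 0) (Fin.last n).succAbove
      = Matrix.of fun i j : Fin n =>
        if (j : ℕ) ≤ (i : ℕ) + 1 then s ((i : ℕ) + 1 - (j : ℕ)) else 0 := by
    ext i j
    rw [Matrix.submatrix_apply, Fin.succAbove_zero, Fin.succAbove_last]
    rfl
  rw [hsub] at key
  rw [dCoeff]
  have hs' : s 0 ^ (n + 1) ≠ 0 := pow_ne_zero _ hs
  simp only [Fin.val_zero, Fin.val_last, zero_add] at key
  field_simp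
  rw [mul_comm, key]

theorem mk_mul_mk_dCoeff {s : ℕ → 𝕜} (hs : s 0 ≠ 0) :
    PowerSeries.mk s * PowerSeries.mk (fun n => (-1) ^ n * dCoeff s n) = 1 := by
  have hinv : PowerSeries.mk s * (PowerSeries.mk s)⁻¹ = 1 :=
    PowerSeries.mul_inv_cancel _ (by simpa [← PowerSeries.coeff_zero_eq_constantCoeff_apply])
  have hc : (PowerSeries.mk s)⁻¹
      = PowerSeries.mk (fun n => PowerSeries.coeff n (PowerSeries.mk s)⁻¹) := by
    ext n; simp
  rw [hc] at hinv
  have : (fun n => PowerSeries.coeff n (PowerSeries.mk s)⁻¹)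
      = fun n => (-1) ^ n * dCoeff s n := funext (eq_dCoeff_of_mul_eq_one hs hinv)
  rwa [this] at hinv

theorem mk_mul_mk_band {u v : 𝕜} (hu : u ≠ 0) :
    (PowerSeries.C u + PowerSeries.C v * PowerSeries.X)
      * PowerSeries.mk (fun n => (-v) ^ n / u ^ (n + 1)) = 1 := by
  ext n
  rw [add_mul, map_add, PowerSeries.coeff_C_mul, mul_assoc, PowerSeries.coeff_C_mul,
    PowerSeries.coeff_one]
  cases n with
  | zero => simp [hu]
  | succ n =>
    rw [PowerSeries.coeff_succ_X_mul]
    simp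
    field_simp
    ring

/-- Both sides are coefficientwise forms of power series identities, `f x = y` and `x = g y`. This
inverts both Toeplitz factors. -/
theorem mk_mul_mk_eq_iff {f g x y : ℕ → 𝕜} (h : PowerSeries.mk f * PowerSeries.mk g = 1) :
    (∀ n, ∑ k ∈ range (n + 1), f (n - k) * x k = y n) ↔
      ∀ n, x n = ∑ k ∈ range (n + 1), g (n - k) * y k := by
  have conv : ∀ a b : ℕ → 𝕜, ∀ n, PowerSeries.coeff n (PowerSeries.mk a * PowerSeries.mk b)
      = ∑ k ∈ range (n + 1), a (n - k) * b k := by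
    intro a b n
    rw [mul_comm, PowerSeries.coeff_mul, Nat.sum_antidiagonal_eq_sum_range_succ_mk]
    simp [mul_comm]
  have h1 : (∀ n, ∑ k ∈ range (n + 1), f (n - k) * x k = y n) ↔
      PowerSeries.mk f * PowerSeries.mk x = PowerSeries.mk y := by
    rw [PowerSeries.ext_iff]; simp only [conv, PowerSeries.coeff_mk]
  have h2 : (∀ n, x n = ∑ k ∈ range (n + 1), g (n - k) * y k) ↔
      PowerSeries.mk x = PowerSeries.mk g * PowerSeries.mk y := by
    rw [PowerSeries.ext_iff]; simp only [conv, PowerSeries.coeff_mk]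
  rw [h1, h2]
  constructor
  · intro e; rw [← e, ← mul_assoc, mul_comm (PowerSeries.mk g), h, one_mul]
  · intro e; rw [e, ← mul_assoc, h, one_mul]

theorem triangleTransform_bandMatrix_eq_iff {u v : 𝕜} (hu : u ≠ 0) {x y : ℕ → 𝕜} :
    triangleTransform (bandMatrix u v) x = y ↔
      ∀ n, x n = ∑ k ∈ range (n + 1), (-v) ^ (n - k) / u ^ (n - k + 1) * y k := by
  have hmk : PowerSeries.C u + PowerSeries.C v * PowerSeries.X
      = PowerSeries.mk (fun n => bandMatrix u v n 0) := by
    ext n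
    rw [map_add, PowerSeries.coeff_C_mul, PowerSeries.coeff_C, PowerSeries.coeff_X,
      PowerSeries.coeff_mk, bandMatrix]
    rcases n with _ | _ | n <;> simp
  have h := mk_mul_mk_band (v := v) hu
  rw [hmk] at h
  rw [← mk_mul_mk_eq_iff h, funext_iff]
  refine forall_congr' fun n => ?_
  rw [triangleTransform]
  have : ∀ k ∈ range (n + 1), bandMatrix u v n k * x k = bandMatrix u v (n - k) 0 * x k := by
    intro k hk
    have hk' : k ≤ n := Nat.lt_succ_iff.1 (Finset.mem_range.1 hk)
    congr 1
    simp only [bandMatrix]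
    congr 1
    · simp only [eq_iff_iff]; omega
    · congr 1
      simp only [eq_iff_iff]; omega
  rw [Finset.sum_congr rfl this]

theorem triangleTransform_meanMatrix_eq_iff {r s t : ℕ → 𝕜} (hr : ∀ n, r n ≠ 0) (hs : s 0 ≠ 0)
    (ht : ∀ n, t n ≠ 0) {x y : ℕ → 𝕜} :
    triangleTransform (meanMatrix r s t) x = y ↔
      ∀ n, x n = ∑ k ∈ range (n + 1), (-1) ^ (n - k) * (dCoeff s (n - k) / t n) * (r k * y k) := by
  have h := mk_mul_mk_eq_iff (x := fun n => t n * x n) (y := fun n => r n * y n)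
    (mk_mul_mk_dCoeff hs)
  rw [funext_iff]
  have h1 : (∀ n, triangleTransform (meanMatrix r s t) x n = y n) ↔
      ∀ n, ∑ k ∈ range (n + 1), s (n - k) * (t k * x k) = r n * y n := by
    refine forall_congr' fun n => ?_
    have : triangleTransform (meanMatrix r s t) x n
        = (∑ k ∈ range (n + 1), s (n - k) * (t k * x k)) / r n := by
      rw [triangleTransform, Finset.sum_div]
      refine Finset.sum_congr rfl fun k hk => ?_
      rw [meanMatrix, if_pos (Nat.lt_succ_iff.1 (Finset.mem_range.1 hk))]
      ring
    rw [this, div_eq_iff (hr n), mul_comm (y n)]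
  rw [h1, h]
  refine forall_congr' fun n => ?_
  have : ∑ k ∈ range (n + 1), (-1) ^ (n - k) * (dCoeff s (n - k) / t n) * (r k * y k)
      = (∑ k ∈ range (n + 1), (-1) ^ (n - k) * dCoeff s (n - k) * (r k * y k)) / t n := by
    rw [Finset.sum_div]
    exact Finset.sum_congr rfl fun k _ => by ring
  rw [this, eq_div_iff (ht n), mul_comm (x n)]

theorem triangleTransform_triangleMul {S T : ℕ → ℕ → 𝕜} (hT : ∀ n k, n < k → T n k = 0)
    (x : ℕ → 𝕜) :
    triangleTransform (triangleMul S T) x = triangleTransform S (triangleTransform T x) := by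
  ext n
  simp only [triangleTransform, triangleMul, Finset.sum_mul, Finset.mul_sum]
  rw [Finset.sum_comm]
  refine Finset.sum_congr rfl fun j hj => ?_
  symm
  rw [Finset.sum_subset (Finset.range_mono (Finset.mem_range.1 hj))]
  · exact Finset.sum_congr rfl fun k _ => by ring
  · intro k _ hk
    rw [hT j k (by simpa using hk)]
    ring

theorem bandMatrix_eq_zero_of_lt {u v : 𝕜} {n k : ℕ} (h : n < k) : bandMatrix u v n k = 0 := by
  rw [bandMatrix, if_neg (by omega), if_neg (by omega)]

theorem triangleTransform_meanBandMatrix_eq_iff {r s t : ℕ → 𝕜} {u v : 𝕜} (hr : ∀ n, r n ≠ 0)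
    (hs : s 0 ≠ 0) (ht : ∀ n, t n ≠ 0) (hu : u ≠ 0) {x y : ℕ → 𝕜} :
    triangleTransform (meanBandMatrix r s t u v) x = y ↔
      ∀ l, x l = ∑ j ∈ range (l + 1), (-v) ^ (l - j) / u ^ (l - j + 1) *
        ∑ k ∈ range (j + 1), (-1) ^ (j - k) * (dCoeff s (j - k) / t j) * (r k * y k) := by
  rw [meanBandMatrix, triangleTransform_triangleMul fun n k => bandMatrix_eq_zero_of_lt,
    triangleTransform_meanMatrix_eq_iff hr hs ht, ← triangleTransform_bandMatrix_eq_iff hu,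
    funext_iff]

theorem eMatrix_eq_zero_of_lt {r s t : ℕ → 𝕜} {u v : 𝕜} {a : ℕ → 𝕜} {n k : ℕ} (h : n < k) :
    eMatrix r s t u v a n k = 0 := by
  rw [eMatrix, if_neg (by omega)]

theorem sum_Icc_eq_add_sum_Icc_succ {M : Type*} [AddCommMonoid M] (f : ℕ → M) {k n : ℕ}
    (h : k ≤ n) : ∑ j ∈ Icc k n, f j = f k + ∑ j ∈ Icc (k + 1) n, f j := by
  rw [← Finset.insert_Icc_succ_left_eq_Icc h, Finset.sum_insert (by simp)]
  rfl

/-- The three terms of `eMatrix` are this double sum cut up: the term `j = l = k` gives `aₖ/(u s₀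
tₖ)`, the rest of `j = k` and all of `j = k + 1` have `l ≥ k + 1`, and `j ≥ k + 2` is the last term.
-/
theorem eMatrix_eq_sum {r s t : ℕ → 𝕜} {u v : 𝕜} {a : ℕ → 𝕜} {n k : ℕ} (h : k ≤ n) :
    eMatrix r s t u v a n k = r k * ∑ j ∈ Icc k n, (-1) ^ (j - k) * (dCoeff s (j - k) / t j)
      * ∑ l ∈ Icc j n, (-v) ^ (l - j) / u ^ (l - j + 1) * a l := by
  have hD : dCoeff s 0 = 1 / s 0 := by simp [dCoeff]
  rw [eMatrix, if_pos h, sum_Icc_eq_add_sum_Icc_succ _ (Nat.le_succ k),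
    sum_Icc_eq_add_sum_Icc_succ _ h]
  rw [sum_Icc_eq_add_sum_Icc_succ (fun l => (-v) ^ (l - k) / u ^ (l - k + 1) * a l) h,
    Nat.succ_eq_add_one, Finset.Icc_self, Finset.sum_singleton]
  congr 1
  rcases h.eq_or_lt with rfl | h'
  · simp [hD]
    ring
  · rw [sum_Icc_eq_add_sum_Icc_succ (fun j => (-1) ^ (j - k) * (dCoeff s (j - k) / t j)
      * ∑ l ∈ Icc j n, (-v) ^ (l - j) / u ^ (l - j + 1) * a l) (show k + 1 ≤ n from h')]
    simp only [Nat.sub_self, pow_zero, hD]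
    rw [show k + 1 + 1 = k + 2 from rfl]
    ring

theorem sum_range_sum_range_comm {M : Type*} [AddCommMonoid M] (f : ℕ → ℕ → M) (n : ℕ) :
    ∑ i ∈ range (n + 1), ∑ j ∈ range (i + 1), f i j
      = ∑ j ∈ range (n + 1), ∑ i ∈ Icc j n, f i j := by
  refine Finset.sum_comm' fun i j => ?_
  simp only [Finset.mem_range, Finset.mem_Icc]
  omega

theorem sum_mul_eq_triangleTransform_eMatrix {r s t : ℕ → 𝕜} {u v : 𝕜} (hr : ∀ n, r n ≠ 0)
    (hs : s 0 ≠ 0) (ht : ∀ n, t n ≠ 0) (hu : u ≠ 0) (a x : ℕ → 𝕜) (n : ℕ) :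
    ∑ l ∈ range (n + 1), a l * x l = triangleTransform (eMatrix r s t u v a)
      (triangleTransform (meanBandMatrix r s t u v) x) n := by
  set y := triangleTransform (meanBandMatrix r s t u v) x with hy
  have hx := (triangleTransform_meanBandMatrix_eq_iff hr hs ht hu).1 hy.symm
  calc ∑ l ∈ range (n + 1), a l * x l
      = ∑ l ∈ range (n + 1), ∑ j ∈ range (l + 1), (-v) ^ (l - j) / u ^ (l - j + 1) * a l *
        ∑ k ∈ range (j + 1), (-1) ^ (j - k) * (dCoeff s (j - k) / t j) * (r k * y k) := by
        refine Finset.sum_congr rfl fun l _ => ?_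
        rw [hx l, Finset.mul_sum]
        exact Finset.sum_congr rfl fun j _ => by ring
    _ = ∑ j ∈ range (n + 1), ∑ k ∈ range (j + 1),
          (-1) ^ (j - k) * (dCoeff s (j - k) / t j) * (r k * y k) *
            ∑ l ∈ Icc j n, (-v) ^ (l - j) / u ^ (l - j + 1) * a l := by
        rw [sum_range_sum_range_comm]
        refine Finset.sum_congr rfl fun j _ => ?_
        rw [← Finset.sum_mul, mul_comm, ← Finset.sum_mul]
    _ = triangleTransform (eMatrix r s t u v a) y n := by
        rw [sum_range_sum_range_comm, triangleTransform]
        refine Finset.sum_congr rfl fun k hk => ?_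
        rw [eMatrix_eq_sum (Nat.lt_succ_iff.1 (Finset.mem_range.1 hk)), Finset.mul_sum,
          Finset.sum_mul]
        exact Finset.sum_congr rfl fun j _ => by ring

/-- `T` maps `U` into the bounded sequences. -/
def MapsToBounded (T : ℕ → ℕ → 𝕜) (U : Set (ℕ → 𝕜)) : Prop :=
  ∀ y ∈ U, BddAbove (Set.range fun n => ‖triangleTransform T y n‖)

theorem mem_gammaDual_meanBandSpace_iff {r s t : ℕ → 𝕜} {u v : 𝕜} (hr : ∀ n, r n ≠ 0)
    (hs : s 0 ≠ 0) (ht : ∀ n, t n ≠ 0) (hu : u ≠ 0) {U : Set (ℕ → 𝕜)} {a : ℕ → 𝕜} :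
    a ∈ gammaDual (meanBandSpace r s t u v U) ↔ MapsToBounded (eMatrix r s t u v a) U := by
  have key : ∀ x, (fun k => a k * x k) ∈ bs ↔ BddAbove (Set.range fun n =>
      ‖triangleTransform (eMatrix r s t u v a)
        (triangleTransform (meanBandMatrix r s t u v) x) n‖) := by
    intro x
    simp only [bs, Set.mem_ofPred_eq, sum_mul_eq_triangleTransform_eMatrix hr hs ht hu (v := v)]
  constructor
  · intro h y hy
    -- The inverse formula supplies a preimage of `y`, so every element of `U` is tested.
    have hx := (triangleTransform_meanBandMatrix_eq_iff (v := v) hr hs ht hu (y := y)).2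
      fun l => rfl
    rw [← hx] at hy ⊢
    exact (key _).1 (h _ hy)
  · intro h x hx
    exact (key x).2 (h _ hx)

end Inverse

/-! ### Gliding hump and termwise bounds for lower triangular matrices -/

section BoundedTransforms

variable {𝕜 : Type*} [RCLike 𝕜]

theorem MapsToBounded.exists_column_bound {T : ℕ → ℕ → 𝕜} {U : Set (ℕ → 𝕜)}
    (h : MapsToBounded T U) (hT : ∀ n k, n < k → T n k = 0)
    (hU : ∀ k, (Pi.single k 1 : ℕ → 𝕜) ∈ U) : ∃ C : ℕ → ℝ, ∀ n k, ‖T n k‖ ≤ C k := by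
  have : ∀ k, ∃ C : ℝ, ∀ n, ‖T n k‖ ≤ C := by
    intro k
    obtain ⟨C, hC⟩ := h _ (hU k)
    refine ⟨C, fun n => ?_⟩
    have e : triangleTransform T (Pi.single k 1) n = T n k := by
      rw [triangleTransform]
      by_cases hk : k ≤ n
      · rw [Finset.sum_eq_single k]
        · simp
        · intro j _ hj; simp [hj]
        · intro hk'; exact absurd (Finset.mem_range.2 (Nat.lt_succ_of_le hk)) hk'
      · rw [hT n k (not_le.1 hk)]
        refine Finset.sum_eq_zero fun j hj => ?_
        have : j ≠ k := by have := Finset.mem_range.1 hj; omega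
        simp [this]
    rw [← e]
    exact hC ⟨n, rfl⟩
  choose C hC using this
  exact ⟨C, fun n k => hC k n⟩

theorem exists_block_index {N : ℕ → ℕ} (hN : StrictMono N) (h0 : N 0 = 0) :
    ∃ b : ℕ → ℕ, Tendsto b atTop atTop ∧ ∀ k, N (b k) ≤ k ∧ k < N (b k + 1) := by
  have : ∀ k, ∃ i, N i ≤ k ∧ k < N (i + 1) := by
    intro k
    induction k with
    | zero => exact ⟨0, h0.le, (Nat.zero_le _).trans_lt (hN (Nat.lt_succ_self 0))⟩
    | succ k ih =>
      obtain ⟨i, h1, h2⟩ := ih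
      by_cases h : k + 1 < N (i + 1)
      · exact ⟨i, by omega, h⟩
      · have : N (i + 1) < N (i + 1 + 1) := hN (Nat.lt_succ_self _)
        exact ⟨i + 1, by omega, by omega⟩
  choose b hb using this
  refine ⟨b, tendsto_atTop.2 fun m => ?_, hb⟩
  filter_upwards [eventually_ge_atTop (N m)] with k hk
  exact Nat.lt_succ_iff.1 (hN.lt_iff_lt.1 (hk.trans_lt (hb k).2))

/-- Gliding hump: if a triangle with bounded columns is unbounded on weights beyond every index,
then some sequence assembled from consecutive blocks of such weights has unbounded transform. -/
theorem exists_not_bddAbove_triangleTransform {T : ℕ → ℕ → 𝕜} {C W : ℕ → ℝ}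
    (hC : ∀ n k, ‖T n k‖ ≤ C k) {Q : ℕ → (ℕ → ℝ) → Prop}
    (h : ∀ (K : ℕ) (R : ℝ), ∃ (n : ℕ) (w : ℕ → ℝ), (∀ k, 0 ≤ w k ∧ w k ≤ W k) ∧ Q K w ∧
      R ≤ ∑ k ∈ Ico K (n + 1), ‖T n k‖ * w k) :
    ∃ (N : ℕ → ℕ) (w : ℕ → ℕ → ℝ) (y : ℕ → 𝕜), StrictMono N ∧ N 0 = 0 ∧ (∀ i, Q (N i) (w i)) ∧
      (∀ i k, N i ≤ k → k < N (i + 1) → ‖y k‖ ≤ w i k) ∧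
      ¬ BddAbove (Set.range fun n => ‖triangleTransform T y n‖) := by
  -- The sum dominates whatever the earlier columns contribute, `K` makes the excess unbounded, and
  -- `1` prevents the block from being empty.
  choose n w hw hQ hR using fun K : ℕ => h K (1 + K + ∑ k ∈ range K, C k * W k)
  have hW : ∀ k, 0 ≤ W k := fun k => (hw 0 k).1.trans (hw 0 k).2
  have hC0 : ∀ k, 0 ≤ C k := fun k => (norm_nonneg _).trans (hC 0 k)
  have hK : ∀ K, K < n K + 1 := by
    intro K
    by_contra hlt
    have h1 := hR K
    rw [Finset.Ico_eq_empty_of_le (not_lt.1 hlt), Finset.sum_empty] at h1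
    have h2 : 0 ≤ ∑ k ∈ range K, C k * W k :=
      Finset.sum_nonneg fun k _ => mul_nonneg (hC0 k) (hW k)
    have h3 : (0 : ℝ) ≤ K := Nat.cast_nonneg K
    linarith
  let N : ℕ → ℕ := fun i => (fun K => n K + 1)^[i] 0
  have hN1 : ∀ i, N (i + 1) = n (N i) + 1 := fun i => Function.iterate_succ_apply' _ _ _
  have hN : StrictMono N := strictMono_nat_of_lt_succ fun i => by rw [hN1]; exact hK _
  obtain ⟨b, -, hb⟩ := exists_block_index hN rfl
  have hbu : ∀ i k, N i ≤ k → k < N (i + 1) → b k = i := fun i k h1 h2 =>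
    le_antisymm (Nat.lt_succ_iff.1 (hN.lt_iff_lt.1 ((hb k).1.trans_lt h2)))
      (Nat.lt_succ_iff.1 (hN.lt_iff_lt.1 (h1.trans_lt (hb k).2)))
  -- The conjugate phase turns the block of row `n (N i)` into `∑ ‖T‖ w`. Where the entry vanishes
  -- the phase is `0 / 0 = 0`, so `‖y k‖ ≤ w` still holds.
  let y : ℕ → 𝕜 := fun k => (w (N (b k)) k : 𝕜) *
    (starRingEnd 𝕜 (T (n (N (b k))) k) / (‖T (n (N (b k))) k‖ : 𝕜))
  have hy : ∀ k, ‖y k‖ ≤ w (N (b k)) k := by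
    intro k
    simp only [y, norm_mul, norm_div, RCLike.norm_conj, RCLike.norm_ofReal, abs_norm]
    rw [abs_of_nonneg (hw _ _).1]
    exact mul_le_of_le_one_right (hw _ _).1 (div_self_le_one _)
  refine ⟨N, fun i => w (N i), y, hN, rfl, fun i => hQ _, ?_, ?_⟩
  · intro i k h1 h2
    have := hy k
    rwa [hbu i k h1 h2] at this
  · rintro ⟨M, hM⟩
    obtain ⟨i, hi⟩ := exists_nat_gt M
    have hle := hM ⟨n (N i), rfl⟩
    simp only [triangleTransform] at hle
    rw [← Finset.sum_range_add_sum_Ico _ (hK (N i)).le] at hle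
    have hblock : ∑ k ∈ Ico (N i) (n (N i) + 1), T (n (N i)) k * y k
        = ((∑ k ∈ Ico (N i) (n (N i) + 1), ‖T (n (N i)) k‖ * w (N i) k : ℝ) : 𝕜) := by
      push_cast
      refine Finset.sum_congr rfl fun k hk => ?_
      obtain ⟨h1, h2⟩ := Finset.mem_Ico.1 hk
      simp only [y]
      rw [hbu i k h1 (by rwa [hN1])]
      rcases eq_or_ne (T (n (N i)) k) 0 with h0 | h0
      · simp [h0]
      · have h0' : (‖T (n (N i)) k‖ : 𝕜) ≠ 0 := by simpa using h0
        rw [mul_left_comm, mul_div_assoc', RCLike.mul_conj]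
        field_simp
    have hhead : ‖∑ k ∈ range (N i), T (n (N i)) k * y k‖ ≤ ∑ k ∈ range (N i), C k * W k := by
      refine (norm_sum_le _ _).trans (Finset.sum_le_sum fun k _ => ?_)
      rw [norm_mul]
      exact mul_le_mul (hC _ _) ((hy k).trans (hw _ _).2) (norm_nonneg _) (hC0 k)
    rw [hblock] at hle
    have h1 := norm_sub_le_norm_add
      (((∑ k ∈ Ico (N i) (n (N i) + 1), ‖T (n (N i)) k‖ * w (N i) k : ℝ) : 𝕜))
      (∑ k ∈ range (N i), T (n (N i)) k * y k)
    rw [add_comm (_ : 𝕜), RCLike.norm_ofReal] at h1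
    have h2 := hR (N i)
    have h3 := le_abs_self (∑ k ∈ Ico (N i) (n (N i) + 1), ‖T (n (N i)) k‖ * w (N i) k)
    have h4 : (i : ℝ) ≤ N i := by exact_mod_cast hN.id_le i
    linarith

/-- The first `K` columns are controlled by `C`, the others by `g`; this lets a bound on `y` hold
only eventually. -/
theorem bddAbove_triangleTransform {T : ℕ → ℕ → 𝕜} {C : ℕ → ℝ} {y : ℕ → 𝕜} {g : ℕ → ℕ → ℝ}
    {K : ℕ} {M : ℝ} (hC : ∀ n, ∀ k < K, ‖T n k‖ ≤ C k) (hg0 : ∀ n k, 0 ≤ g n k)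
    (hg : ∀ n, ∑ k ∈ range (n + 1), g n k ≤ M)
    (h : ∀ n k, K ≤ k → ‖T n k‖ * ‖y k‖ ≤ g n k) :
    BddAbove (Set.range fun n => ‖triangleTransform T y n‖) := by
  refine ⟨M + ∑ k ∈ range K, C k * ‖y k‖, ?_⟩
  rintro _ ⟨n, rfl⟩
  have hC0 : ∀ k < K, 0 ≤ C k * ‖y k‖ := fun k hk =>
    mul_nonneg ((norm_nonneg _).trans (hC 0 k hk)) (norm_nonneg _)
  calc ‖triangleTransform T y n‖ ≤ ∑ k ∈ range (n + 1), ‖T n k * y k‖ := norm_sum_le _ _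
    _ ≤ ∑ k ∈ range (n + 1), (g n k + if k ∈ range K then C k * ‖y k‖ else 0) := by
      refine Finset.sum_le_sum fun k _ => ?_
      rw [norm_mul]
      by_cases hk : k < K
      · rw [if_pos (Finset.mem_range.2 hk)]
        have := mul_le_mul_of_nonneg_right (hC n k hk) (norm_nonneg (y k))
        linarith [hg0 n k]
      · rw [if_neg (by simpa using hk), add_zero]
        exact h n k (not_lt.1 hk)
    _ = ∑ k ∈ range (n + 1), g n k + ∑ k ∈ range (n + 1) ∩ range K, C k * ‖y k‖ := by
      rw [Finset.sum_add_distrib, Finset.sum_ite_mem]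
    _ ≤ _ := by
      refine add_le_add (hg n) (Finset.sum_le_sum_of_subset_of_nonneg
        Finset.inter_subset_right fun k hk _ => hC0 k (Finset.mem_range.1 hk))

theorem sum_range_sub_sum_range_le_sum_Ico {f : ℕ → ℝ} (hf : ∀ k, 0 ≤ f k) (K m : ℕ) :
    ∑ k ∈ range m, f k - ∑ k ∈ range K, f k ≤ ∑ k ∈ Ico K m, f k := by
  rcases le_total K m with h | h
  · rw [← Finset.sum_range_add_sum_Ico _ h]; linarith
  · rw [Finset.Ico_eq_empty_of_le h, Finset.sum_empty, sub_nonpos]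
    exact Finset.sum_le_sum_of_subset_of_nonneg (Finset.range_mono h) fun k _ _ => hf k

theorem le_of_sum_range_le {g : ℕ → ℕ → ℝ} (hg0 : ∀ n k, 0 ≤ g n k)
    (hg : ∀ n k, n < k → g n k = 0) {M : ℝ} (h : ∀ n, ∑ k ∈ range (n + 1), g n k ≤ M) (n k : ℕ) :
    g n k ≤ M := by
  have h0 := (Finset.sum_nonneg fun k _ => hg0 n k).trans (h n)
  rcases lt_or_ge n k with hk | hk
  · rwa [hg n k hk]
  · exact (Finset.single_le_sum (fun k _ => hg0 n k)
      (Finset.mem_range.2 (Nat.lt_succ_of_le hk))).trans (h n)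

theorem norm_single_rpow {p : ℕ → ℝ} (hp : ∀ k, 0 < p k) (k j : ℕ) :
    ‖(Pi.single k 1 : ℕ → 𝕜) j‖ ^ p j = if j = k then 1 else 0 := by
  by_cases h : j = k
  · subst h; simp
  · simp [h, (hp j).ne']

theorem single_mem_maddoxL {p : ℕ → ℝ} (hp : ∀ k, 0 < p k) (k : ℕ) :
    (Pi.single k 1 : ℕ → 𝕜) ∈ maddoxL p := by
  simp only [maddoxL, Set.mem_ofPred_eq, norm_single_rpow hp]
  exact summable_of_ne_finset_zero (s := {k}) fun j hj => if_neg (by simpa using hj)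

theorem maddoxL_subset_maddoxC0 (p : ℕ → ℝ) : maddoxL (𝕜 := 𝕜) p ⊆ maddoxC0 p :=
  fun _ h => h.tendsto_atTop_zero

theorem maddoxC0_subset_maddoxLInfty (p : ℕ → ℝ) : maddoxC0 (𝕜 := 𝕜) p ⊆ maddoxLInfty p :=
  fun _ h => h.bddAbove_range

/-! ### Matrix maps from `c₀(p)`, `c(p)` and `l_∞(p)` into the bounded sequences -/

theorem mapsToBounded_maddoxC0_iff {T : ℕ → ℕ → 𝕜} (hT : ∀ n k, n < k → T n k = 0)
    {p : ℕ → ℝ} (hp : ∀ k, 0 < p k) :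
    MapsToBounded T (maddoxC0 p) ↔ ∃ L : ℕ, 1 ≤ L ∧ ∃ M : ℝ, ∀ n,
      ∑ k ∈ range (n + 1), ‖T n k‖ * (L : ℝ) ^ (-(1 / p k)) ≤ M := by
  constructor
  · intro h
    obtain ⟨C, hC⟩ := h.exists_column_bound hT
      fun k => maddoxL_subset_maddoxC0 p (single_mem_maddoxL hp k)
    by_contra! hcon
    have hw1 : ∀ K k : ℕ, ((K + 1 : ℕ) : ℝ) ^ (-(1 / p k)) ≤ 1 := fun K k =>
      Real.rpow_le_one_of_one_le_of_nonpos (by exact_mod_cast Nat.succ_pos K)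
        (neg_nonpos.2 (one_div_pos.2 (hp k)).le)
    have hw0 : ∀ K k : ℕ, 0 ≤ ((K + 1 : ℕ) : ℝ) ^ (-(1 / p k)) := fun K k =>
      Real.rpow_nonneg (Nat.cast_nonneg _) _
    obtain ⟨N, w, y, hN, hN0, hw, hy, hunb⟩ := exists_not_bddAbove_triangleTransform
      (W := fun _ => 1) (Q := fun K w => w = fun k => ((K + 1 : ℕ) : ℝ) ^ (-(1 / p k))) hC
      fun K R => by
        -- A block starting at `K` uses `L = K + 1`, so that `‖y k‖ ^ p k ≤ 1 / (K + 1)` there and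
        -- `y` lies in `c₀(p)`.
        obtain ⟨n, hn⟩ := hcon (K + 1) (Nat.succ_pos K) (R + ∑ k ∈ range K, C k)
        refine ⟨n, _, fun k => ⟨hw0 K k, hw1 K k⟩, rfl, ?_⟩
        have h1 := sum_range_sub_sum_range_le_sum_Ico
          (fun k => mul_nonneg (norm_nonneg (T n k)) (hw0 K k)) K (n + 1)
        have h2 : ∑ k ∈ range K, ‖T n k‖ * ((K + 1 : ℕ) : ℝ) ^ (-(1 / p k))
            ≤ ∑ k ∈ range K, C k := Finset.sum_le_sum fun k _ =>
          (mul_le_of_le_one_right (norm_nonneg _) (hw1 K k)).trans (hC n k)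
        linarith
    refine hunb (h y ?_)
    obtain ⟨b, hbt, hb⟩ := exists_block_index hN hN0
    refine squeeze_zero (fun k => Real.rpow_nonneg (norm_nonneg _) _) (fun k => ?_)
      (tendsto_one_div_add_atTop_nhds_zero_nat.comp hbt)
    have h1 := hy (b k) k (hb k).1 (hb k).2
    rw [hw (b k)] at h1
    have h2 : ‖y k‖ ^ p k ≤ ((N (b k) + 1 : ℕ) : ℝ)⁻¹ := by
      rw [← Real.le_rpow_inv_iff_of_pos (norm_nonneg _) (by positivity) (hp k)]
      rwa [Real.inv_rpow (Nat.cast_nonneg _), ← Real.rpow_neg (Nat.cast_nonneg _), ← one_div]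
    refine h2.trans ?_
    rw [Function.comp_apply, one_div]
    have : (b k : ℝ) ≤ N (b k) := by exact_mod_cast hN.id_le (b k)
    push_cast
    gcongr
  · rintro ⟨L, hL, M, hM⟩ y hy
    have hL0 : (0 : ℝ) < L := by exact_mod_cast hL
    have hg0 : ∀ n k, 0 ≤ ‖T n k‖ * (L : ℝ) ^ (-(1 / p k)) := fun n k => by positivity
    have hcol := le_of_sum_range_le hg0 (fun n k hk => by simp [hT n k hk]) hM
    have hev : ∀ᶠ k in atTop, ‖y k‖ ^ p k ≤ (L : ℝ)⁻¹ :=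
      hy.eventually_le_const (by positivity)
    obtain ⟨K, hK⟩ := eventually_atTop.1 hev
    refine bddAbove_triangleTransform (C := fun k => M / (L : ℝ) ^ (-(1 / p k))) (K := K)
      (fun n k _ => (le_div_iff₀ (by positivity)).2 (hcol n k)) hg0 hM fun n k hk => ?_
    refine mul_le_mul_of_nonneg_left ?_ (norm_nonneg _)
    have := (Real.le_rpow_inv_iff_of_pos (norm_nonneg _) (by positivity) (hp k)).2 (hK k hk)
    rwa [Real.inv_rpow hL0.le, ← Real.rpow_neg hL0.le, ← one_div] at this

/-- Each element of `c(p)` is an element of `c₀(p)` plus a constant sequence, and on the constant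
`1` the transform is the row sum. -/
theorem mapsToBounded_maddoxC_iff {T : ℕ → ℕ → 𝕜} {p : ℕ → ℝ} (hp : ∀ k, 0 < p k) :
    MapsToBounded T (maddoxC p) ↔ MapsToBounded T (maddoxC0 p) ∧
      BddAbove (Set.range fun n => ‖∑ k ∈ range (n + 1), T n k‖) := by
  constructor
  · intro h
    refine ⟨fun y hy => h y ⟨0, by simpa [maddoxC0] using hy⟩, ?_⟩
    have h1 := h (fun _ => 1) ⟨1, by simp [(hp _).ne']⟩
    simpa [triangleTransform] using h1
  · rintro ⟨h1, B, hB⟩ y ⟨l, hl⟩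
    obtain ⟨A, hA⟩ := h1 (fun k => y k - l) hl
    refine ⟨A + B * ‖l‖, ?_⟩
    rintro _ ⟨n, rfl⟩
    have e : triangleTransform T y n
        = triangleTransform T (fun k => y k - l) n + (∑ k ∈ range (n + 1), T n k) * l := by
      simp only [triangleTransform, Finset.sum_mul, ← Finset.sum_add_distrib]
      exact Finset.sum_congr rfl fun k _ => by ring
    calc ‖triangleTransform T y n‖ ≤ ‖triangleTransform T (fun k => y k - l) n‖
          + ‖∑ k ∈ range (n + 1), T n k‖ * ‖l‖ := by
          rw [e, ← norm_mul]; exact norm_add_le _ _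
      _ ≤ A + B * ‖l‖ :=
          add_le_add (hA ⟨n, rfl⟩) (mul_le_mul_of_nonneg_right (hB ⟨n, rfl⟩) (norm_nonneg _))

theorem mapsToBounded_maddoxLInfty_iff {T : ℕ → ℕ → 𝕜} (hT : ∀ n k, n < k → T n k = 0)
    {p : ℕ → ℝ} (hp : ∀ k, 0 < p k) :
    MapsToBounded T (maddoxLInfty p) ↔ ∀ L : ℕ, 1 ≤ L → ∃ M : ℝ, ∀ n,
      ∑ k ∈ range (n + 1), ‖T n k‖ * (L : ℝ) ^ (1 / p k) ≤ M := by
  constructor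
  · intro h L _
    obtain ⟨C, hC⟩ := h.exists_column_bound hT fun k =>
      maddoxC0_subset_maddoxLInfty p (maddoxL_subset_maddoxC0 p (single_mem_maddoxL hp k))
    by_contra! hcon
    have hw0 : ∀ k : ℕ, 0 ≤ (L : ℝ) ^ (1 / p k) := fun k => Real.rpow_nonneg (Nat.cast_nonneg _) _
    -- Here a single `L` fails, and the same weights serve in every block: they keep `‖y k‖ ^ p k ≤
    -- L`.
    obtain ⟨N, w, y, hN, hN0, hw, hy, hunb⟩ := exists_not_bddAbove_triangleTransform
      (W := fun k => (L : ℝ) ^ (1 / p k)) (Q := fun _ w => w = fun k => (L : ℝ) ^ (1 / p k)) hC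
      fun K R => by
        obtain ⟨n, hn⟩ := hcon (R + ∑ k ∈ range K, C k * (L : ℝ) ^ (1 / p k))
        refine ⟨n, _, fun k => ⟨hw0 k, le_rfl⟩, rfl, ?_⟩
        have h1 := sum_range_sub_sum_range_le_sum_Ico
          (fun k => mul_nonneg (norm_nonneg (T n k)) (hw0 k)) K (n + 1)
        have h2 : ∑ k ∈ range K, ‖T n k‖ * (L : ℝ) ^ (1 / p k)
            ≤ ∑ k ∈ range K, C k * (L : ℝ) ^ (1 / p k) := Finset.sum_le_sum fun k _ =>
          mul_le_mul_of_nonneg_right (hC n k) (hw0 k)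
        linarith
    refine hunb (h y ⟨L, ?_⟩)
    rintro _ ⟨k, rfl⟩
    obtain ⟨b, -, hb⟩ := exists_block_index hN hN0
    have h1 := hy (b k) k (hb k).1 (hb k).2
    rw [hw (b k)] at h1
    dsimp only at h1
    rwa [one_div, Real.le_rpow_inv_iff_of_pos (norm_nonneg _) (Nat.cast_nonneg _) (hp k)] at h1
  · rintro h y ⟨B, hB⟩
    obtain ⟨L, hL⟩ := exists_nat_ge (max B 1)
    obtain ⟨M, hM⟩ := h L (by exact_mod_cast (le_max_right B 1).trans hL)
    refine bddAbove_triangleTransform (C := 0) (K := 0) (fun n k hk => absurd hk (Nat.not_lt_zero k))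
      (fun n k => by positivity) hM fun n k _ => ?_
    refine mul_le_mul_of_nonneg_left ?_ (norm_nonneg _)
    rw [one_div, Real.le_rpow_inv_iff_of_pos (norm_nonneg _) (Nat.cast_nonneg _) (hp k)]
    exact (hB ⟨k, rfl⟩).trans ((le_max_left _ _).trans hL)

/-! ### Matrix maps from `l(p)` into the bounded sequences -/

theorem mem_maddoxL_of_blocks {p : ℕ → ℝ} (hp : ∀ k, 0 < p k) {N : ℕ → ℕ} (hN : StrictMono N)
    (hN0 : N 0 = 0) {w : ℕ → ℕ → ℝ}
    (hw : ∀ i, ∀ s : Finset ℕ, ∑ k ∈ s, w i k ^ p k ≤ (1 / 2) ^ N i)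
    {y : ℕ → 𝕜} (hy : ∀ i k, N i ≤ k → k < N (i + 1) → ‖y k‖ ≤ w i k) : y ∈ maddoxL p := by
  have hnn : ∀ k, 0 ≤ ‖y k‖ ^ p k := fun k => Real.rpow_nonneg (norm_nonneg _) _
  have hpart : ∀ m, ∑ k ∈ range (N m), ‖y k‖ ^ p k ≤ 2 - 2 * (1 / 2) ^ m := by
    intro m
    induction m with
    | zero => simp [hN0]
    | succ m ih =>
      rw [← Finset.sum_range_add_sum_Ico _ (hN (Nat.lt_succ_self m)).le]
      have h1 : ∑ k ∈ Ico (N m) (N (m + 1)), ‖y k‖ ^ p k ≤ (1 / 2) ^ m := by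
        calc _ ≤ ∑ k ∈ Ico (N m) (N (m + 1)), w m k ^ p k := Finset.sum_le_sum fun k hk =>
              Real.rpow_le_rpow (norm_nonneg _)
                (hy m k (Finset.mem_Ico.1 hk).1 (Finset.mem_Ico.1 hk).2) (hp k).le
          _ ≤ (1 / 2) ^ N m := hw m _
          _ ≤ (1 / 2) ^ m := pow_le_pow_of_le_one (by norm_num) (by norm_num) (hN.id_le m)
      have h2 : (2 : ℝ) * (1 / 2) ^ (m + 1) = (1 / 2) ^ m := by rw [pow_succ]; ring
      simp only [Nat.succ_eq_add_one] at *
      linarith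
  refine summable_of_sum_range_le (c := 2) hnn fun m => ?_
  have h1 := Finset.sum_le_sum_of_subset_of_nonneg (Finset.range_mono (hN.id_le m))
    fun k _ _ => hnn k
  have h2 : (0 : ℝ) ≤ 2 * (1 / 2) ^ m := by positivity
  exact h1.trans ((hpart m).trans (by linarith))

/-- The common part of the necessity proofs for `l(p)`. -/
theorem not_mapsToBounded_maddoxL {T : ℕ → ℕ → 𝕜} {p : ℕ → ℝ} (hp : ∀ k, 0 < p k) {C : ℕ → ℝ}
    (hC : ∀ n k, ‖T n k‖ ≤ C k)
    (h : ∀ (K : ℕ) (R : ℝ), ∃ (n : ℕ) (w : ℕ → ℝ), (∀ k, 0 ≤ w k) ∧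
      (∀ s : Finset ℕ, ∑ k ∈ s, w k ^ p k ≤ (1 / 2) ^ K) ∧
      R ≤ ∑ k ∈ Ico K (n + 1), ‖T n k‖ * w k) : ¬ MapsToBounded T (maddoxL p) := by
  intro hb
  obtain ⟨N, w, y, hN, hN0, hw, hy, hunb⟩ := exists_not_bddAbove_triangleTransform
    (W := fun _ => 1) (Q := fun K w => ∀ s : Finset ℕ, ∑ k ∈ s, w k ^ p k ≤ (1 / 2) ^ K) hC
    fun K R => by
      obtain ⟨n, w, h0, hs, hR⟩ := h K R
      refine ⟨n, w, fun k => ⟨h0 k, ?_⟩, hs, hR⟩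
      have h1 := hs {k}
      rw [Finset.sum_singleton] at h1
      have h2 : w k ^ p k ≤ 1 := h1.trans (pow_le_one₀ (by norm_num) (by norm_num))
      rw [← Real.le_rpow_inv_iff_of_pos (h0 k) zero_le_one (hp k), Real.one_rpow] at h2
      exact h2
  exact hunb (hb y (mem_maddoxL_of_blocks hp hN hN0 hw hy))

theorem norm_mul_inv_natCast (z : 𝕜) (L : ℕ) : ‖z * (L : 𝕜)⁻¹‖ = ‖z‖ / L := by
  rw [norm_mul, norm_inv, RCLike.norm_natCast, div_eq_mul_inv]

theorem mapsToBounded_maddoxL_iff_of_le_one {T : ℕ → ℕ → 𝕜} (hT : ∀ n k, n < k → T n k = 0)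
    {p : ℕ → ℝ} (hp : ∀ k, 0 < p k) (hp1 : ∀ k, p k ≤ 1) :
    MapsToBounded T (maddoxL p) ↔ ∃ L : ℕ, 1 ≤ L ∧ ∃ M : ℝ, ∀ n k,
      ‖T n k * (L : 𝕜)⁻¹‖ ^ p k ≤ M := by
  simp only [norm_mul_inv_natCast]
  constructor
  · intro h
    obtain ⟨C, hC⟩ := h.exists_column_bound hT fun k => single_mem_maddoxL hp k
    have hC0 : ∀ k, 0 ≤ C k := fun k => (norm_nonneg _).trans (hC 0 k)
    by_contra! hcon
    refine not_mapsToBounded_maddoxL hp hC (fun K R => ?_) h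
    obtain ⟨L, hL⟩ := exists_nat_ge (max R 1)
    have hL1 : (1 : ℝ) ≤ L := (le_max_right R 1).trans hL
    have hL0 : (0 : ℝ) < L := one_pos.trans_le hL1
    -- The hump is a single spike at `k`. The sum forces `k ≥ K`; the factor `2 ^ K` offsets the `p
    -- k`-th power `(1/2) ^ K` allotted to the spike.
    obtain ⟨n, k, hnk⟩ := hcon L (by exact_mod_cast hL1) (2 ^ K + ∑ j ∈ range K, C j ^ p j)
    have hsum : 0 ≤ ∑ j ∈ range K, C j ^ p j :=
      Finset.sum_nonneg fun j _ => Real.rpow_nonneg (hC0 j) _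
    have hpow : (0 : ℝ) < 2 ^ K := by positivity
    have hkK : K ≤ k := by
      by_contra hk
      have h1 : (‖T n k‖ / L) ^ p k ≤ C k ^ p k := Real.rpow_le_rpow (by positivity)
        ((div_le_self (norm_nonneg _) hL1).trans (hC n k)) (hp k).le
      have h2 : C k ^ p k ≤ ∑ j ∈ range K, C j ^ p j :=
        Finset.single_le_sum (f := fun j => C j ^ p j)
          (fun j _ => Real.rpow_nonneg (hC0 j) _) (Finset.mem_range.2 (not_le.1 hk))
      linarith
    have hkn : k ≤ n := by
      by_contra hk
      rw [hT n k (not_le.1 hk), norm_zero, zero_div, Real.zero_rpow (hp k).ne'] at hnk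
      linarith
    have hδ : (0 : ℝ) < (1 / 2) ^ K := by positivity
    refine ⟨n, Pi.single k (((1 / 2) ^ K) ^ (p k)⁻¹), fun j => ?_, fun s => ?_, ?_⟩
    · by_cases hj : j = k
      · subst hj; simp only [Pi.single_eq_same]; positivity
      · simp [hj]
    · calc ∑ j ∈ s, (Pi.single k (((1 / 2 : ℝ) ^ K) ^ (p k)⁻¹) : ℕ → ℝ) j ^ p j
          = ∑ j ∈ s, if k = j then (1 / 2 : ℝ) ^ K else 0 := by
            refine Finset.sum_congr rfl fun j _ => ?_
            by_cases hj : k = j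
            · subst hj
              rw [if_pos rfl, Pi.single_eq_same, Real.rpow_inv_rpow hδ.le (hp k).ne']
            · rw [if_neg hj, Pi.single_eq_of_ne (Ne.symm hj), Real.zero_rpow (hp j).ne']
        _ ≤ (1 / 2) ^ K := by
            rw [Finset.sum_ite_eq]
            split_ifs
            · exact le_rfl
            · exact hδ.le
    · refine le_trans ?_ (Finset.single_le_sum (a := k) (fun j _ => ?_)
        (Finset.mem_Ico.2 ⟨hkK, Nat.lt_succ_of_le hkn⟩))
      · rw [Pi.single_eq_same]
        have h1 : 1 ≤ ‖T n k‖ / L * ((1 / 2) ^ K) ^ (p k)⁻¹ := by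
          have h2 : (2 : ℝ) ^ K ≤ (‖T n k‖ / L) ^ p k := by linarith
          have h3 : ((2 : ℝ) ^ K) ^ (p k)⁻¹ ≤ ‖T n k‖ / L :=
            (Real.rpow_inv_le_iff_of_pos hpow.le (by positivity) (hp k)).2 h2
          calc (1 : ℝ) = ((2 : ℝ) ^ K) ^ (p k)⁻¹ * ((1 / 2) ^ K) ^ (p k)⁻¹ := by
                rw [← Real.mul_rpow hpow.le hδ.le, ← mul_pow]; norm_num
            _ ≤ _ := mul_le_mul_of_nonneg_right h3 (by positivity)
        rw [div_mul_eq_mul_div, le_div_iff₀ hL0, one_mul] at h1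
        exact ((le_max_left R 1).trans hL).trans h1
      · refine mul_nonneg (norm_nonneg _) ?_
        by_cases hj : j = k
        · subst hj; simp only [Pi.single_eq_same]; positivity
        · simp [hj]
  · rintro ⟨L, hL, M, hM⟩ y hy
    have hL0 : (0 : ℝ) < L := by exact_mod_cast hL
    have hM0 : 0 ≤ M := (Real.rpow_nonneg (by positivity) _).trans (hM 0 0)
    have hy0 : ∀ k, 0 ≤ ‖y k‖ ^ p k := fun k => Real.rpow_nonneg (norm_nonneg _) _
    have hlim : Tendsto (fun k => M * ‖y k‖ ^ p k) atTop (𝓝 0) := by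
      simpa using (maddoxL_subset_maddoxC0 p hy).const_mul M
    obtain ⟨K, hK⟩ := eventually_atTop.1 (hlim.eventually_le_const one_pos)
    refine bddAbove_triangleTransform (C := fun k => M ^ (p k)⁻¹ * L) (K := K)
      (g := fun _ k => L * (M * ‖y k‖ ^ p k)) (M := L * (M * ∑' k, ‖y k‖ ^ p k))
      (fun n k _ => ?_) (fun n k => by have := hy0 k; positivity) (fun n => ?_)
      fun n k hk => ?_
    · rw [← div_le_iff₀ hL0, Real.le_rpow_inv_iff_of_pos (by positivity) hM0 (hp k)]
      exact hM n k
    · rw [← Finset.mul_sum, ← Finset.mul_sum]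
      gcongr
      exact hy.sum_le_tsum _ fun k _ => hy0 k
    · have h1 : (‖T n k‖ / L * ‖y k‖) ^ p k ≤ M * ‖y k‖ ^ p k := by
        rw [Real.mul_rpow (by positivity) (norm_nonneg _)]
        exact mul_le_mul_of_nonneg_right (hM n k) (hy0 k)
      have h0 : 0 ≤ ‖T n k‖ / L * ‖y k‖ := by positivity
      have h2 : ‖T n k‖ / L * ‖y k‖ ≤ 1 := by
        have := h1.trans (hK k hk)
        rwa [← Real.le_rpow_inv_iff_of_pos h0 zero_le_one (hp k), Real.one_rpow] at this
      -- For `p k ≤ 1`, a number in `[0, 1]` is at most its `p k`-th power; this is why `K` was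
      -- chosen to make the product at most `1`.
      have h3 := (Real.self_le_rpow_of_le_one h0 h2 (hp1 k)).trans h1
      calc ‖T n k‖ * ‖y k‖ = L * (‖T n k‖ / L * ‖y k‖) := by field_simp
        _ ≤ _ := mul_le_mul_of_nonneg_left h3 hL0.le

theorem mapsToBounded_maddoxL_iff_of_one_lt {T : ℕ → ℕ → 𝕜} (hT : ∀ n k, n < k → T n k = 0)
    {p : ℕ → ℝ} (hp1 : ∀ k, 1 < p k) :
    MapsToBounded T (maddoxL p) ↔ ∃ L : ℕ, 1 ≤ L ∧ ∃ M : ℝ, ∀ n,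
      ∑ k ∈ range (n + 1), ‖T n k * (L : 𝕜)⁻¹‖ ^ (p k / (p k - 1)) ≤ M := by
  simp only [norm_mul_inv_natCast]
  have hp : ∀ k, 0 < p k := fun k => one_pos.trans (hp1 k)
  have hpq : ∀ k, (p k).HolderConjugate (p k / (p k - 1)) := fun k =>
    Real.HolderConjugate.conjExponent (hp1 k)
  have hq : ∀ k, 1 < p k / (p k - 1) := fun k => (hpq k).symm.lt
  constructor
  · intro h
    obtain ⟨C, hC⟩ := h.exists_column_bound hT fun k => single_mem_maddoxL hp k
    by_contra! hcon
    refine not_mapsToBounded_maddoxL hp hC (fun K R => ?_) h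
    have hδ : (0 : ℝ) < (1 / 2) ^ K := by positivity
    set δ : ℝ := (1 / 2) ^ K
    -- The weights below give the block sum `L * δ`, which must reach `R`.
    obtain ⟨L, hL⟩ := exists_nat_ge (max (R / δ) 1)
    have hL1 : (1 : ℝ) ≤ L := (le_max_right _ 1).trans hL
    have hL0 : (0 : ℝ) < L := one_pos.trans_le hL1
    obtain ⟨n, hn⟩ := hcon L (by exact_mod_cast hL1)
      (δ + ∑ k ∈ range K, C k ^ (p k / (p k - 1)))
    set z : ℕ → ℝ := fun k => ‖T n k‖ / L
    have hz : ∀ k, 0 ≤ z k := fun k => by positivity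
    set S := ∑ k ∈ Ico K (n + 1), z k ^ (p k / (p k - 1)) with hS
    have hδS : δ ≤ S := by
      have h1 := sum_range_sub_sum_range_le_sum_Ico
        (fun k => Real.rpow_nonneg (hz k) (p k / (p k - 1))) K (n + 1)
      have h2 : ∑ k ∈ range K, z k ^ (p k / (p k - 1))
          ≤ ∑ k ∈ range K, C k ^ (p k / (p k - 1)) := Finset.sum_le_sum fun k _ =>
        Real.rpow_le_rpow (hz k) ((div_le_self (norm_nonneg _) hL1).trans (hC n k))
          (zero_le_one.trans (hq k).le)
      linarith
    have hS0 : 0 < S := hδ.trans_le hδS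
    have hl0 : 0 ≤ δ / S := by positivity
    have hl1 : δ / S ≤ 1 := (div_le_one hS0).2 hδS
    -- With `q = p / (p - 1)`, these are the extremal weights `z ^ (q - 1)` of Hölder's inequality:
    -- `(q - 1) p = q`. As `δ / S ≤ 1` and `p k > 1`, `(δ / S) ^ p k ≤ δ / S`, which bounds the sum
    -- of the powers by `δ` although the exponents vary.
    refine ⟨n, fun k => if k ∈ Ico K (n + 1) then δ / S * z k ^ (p k / (p k - 1) - 1) else 0,
      fun k => ?_, fun s => ?_, ?_⟩
    · dsimp only
      split_ifs
      · exact mul_nonneg hl0 (Real.rpow_nonneg (hz k) _)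
      · exact le_rfl
    · calc _ ≤ ∑ k ∈ s, if k ∈ Ico K (n + 1) then δ / S * z k ^ (p k / (p k - 1)) else 0 := by
            refine Finset.sum_le_sum fun k _ => ?_
            dsimp only
            split_ifs
            · rw [Real.mul_rpow hl0 (Real.rpow_nonneg (hz k) _), ← Real.rpow_mul (hz k)]
              have e : (p k / (p k - 1) - 1) * p k = p k / (p k - 1) := by
                have : p k - 1 ≠ 0 := (sub_pos.2 (hp1 k)).ne'
                field_simp
                ring
              rw [e]
              refine mul_le_mul_of_nonneg_right ?_ (Real.rpow_nonneg (hz k) _)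
              exact Real.rpow_le_self_of_le_one hl0 hl1 (hp1 k).le
            · rw [Real.zero_rpow (hp k).ne']
        _ = ∑ k ∈ s ∩ Ico K (n + 1), δ / S * z k ^ (p k / (p k - 1)) := Finset.sum_ite_mem _ _ _
        _ ≤ ∑ k ∈ Ico K (n + 1), δ / S * z k ^ (p k / (p k - 1)) :=
            Finset.sum_le_sum_of_subset_of_nonneg Finset.inter_subset_right fun k _ _ =>
              mul_nonneg hl0 (Real.rpow_nonneg (hz k) _)
        _ = δ := by rw [← Finset.mul_sum, ← hS, div_mul_cancel₀ _ hS0.ne']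
    · calc R ≤ L * δ := (div_le_iff₀ hδ).1 ((le_max_left _ 1).trans hL)
        _ = L * (δ / S) * S := by field_simp
        _ = ∑ k ∈ Ico K (n + 1), L * (δ / S) * z k ^ (p k / (p k - 1)) := by
            rw [hS, Finset.mul_sum]
        _ ≤ _ := by
            refine le_of_eq (Finset.sum_congr rfl fun k hk => ?_)
            dsimp only
            rw [if_pos hk]
            have e : z k ^ (p k / (p k - 1)) = z k ^ (p k / (p k - 1) - 1) * z k := by
              rw [← Real.rpow_add_one' (hz k) (by linarith [hq k]), sub_add_cancel]
            have e' : ‖T n k‖ = L * z k := by simp only [z]; field_simp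
            rw [e, e']
            ring
  · rintro ⟨L, hL, M, hM⟩ y hy
    have hL0 : (0 : ℝ) < L := by exact_mod_cast hL
    have hy0 : ∀ k, 0 ≤ ‖y k‖ ^ p k := fun k => Real.rpow_nonneg (norm_nonneg _) _
    refine bddAbove_triangleTransform (C := 0) (K := 0)
      (g := fun n k => L * ((‖T n k‖ / L) ^ (p k / (p k - 1)) + ‖y k‖ ^ p k))
      (M := L * (M + ∑' k, ‖y k‖ ^ p k)) (fun n k hk => absurd hk (Nat.not_lt_zero k))
      (fun n k => by positivity) (fun n => ?_) fun n k _ => ?_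
    · rw [← Finset.mul_sum, Finset.sum_add_distrib]
      refine mul_le_mul_of_nonneg_left (add_le_add (hM n) ?_) hL0.le
      exact hy.sum_le_tsum _ fun k _ => hy0 k
    · have hz : 0 ≤ ‖T n k‖ / L := by positivity
      have h1 := Real.young_inequality_of_nonneg hz (norm_nonneg (y k)) (hpq k).symm
      have h2 := div_le_self (Real.rpow_nonneg hz (p k / (p k - 1))) (hq k).le
      have h3 := div_le_self (hy0 k) (hp1 k).le
      calc ‖T n k‖ * ‖y k‖ = L * (‖T n k‖ / L * ‖y k‖) := by field_simp
        _ ≤ _ := mul_le_mul_of_nonneg_left (by linarith) hL0.le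

end BoundedTransforms

/-! ### Finiteness of suprema in `[0, ∞]` as real bounds -/

section Suprema

theorem iSup_ofReal_lt_top_iff {ι : Type*} {f : ι → ℝ} :
    (⨆ i, ENNReal.ofReal (f i)) < ⊤ ↔ ∃ M : ℝ, ∀ i, f i ≤ M := by
  constructor
  · intro h
    exact ⟨_, fun i => (ENNReal.ofReal_le_iff_le_toReal h.ne).1
      (le_iSup (fun i => ENNReal.ofReal (f i)) i)⟩
  · rintro ⟨M, hM⟩
    exact (iSup_le fun i => ENNReal.ofReal_le_ofReal (hM i)).trans_lt ENNReal.ofReal_lt_top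

theorem iSup_tsum_ofReal_lt_top_iff {g : ℕ → ℕ → ℝ} (hg0 : ∀ n k, 0 ≤ g n k)
    (hg : ∀ n k, n < k → g n k = 0) :
    (⨆ n, ∑' k, ENNReal.ofReal (g n k)) < ⊤ ↔ ∃ M : ℝ, ∀ n, ∑ k ∈ range (n + 1), g n k ≤ M := by
  rw [← iSup_ofReal_lt_top_iff]
  have : ∀ n, ∑' k, ENNReal.ofReal (g n k)
      = ENNReal.ofReal (∑ k ∈ range (n + 1), g n k) := by
    intro n
    rw [tsum_eq_sum (s := range (n + 1)), ENNReal.ofReal_sum_of_nonneg fun k _ => hg0 n k]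
    intro k hk
    rw [hg n k (by simpa using hk), ENNReal.ofReal_zero]
  simp only [this]

end Suprema

end GenMeans

/-! ### Assembly of the duals -/

theorem theorem4p5 {𝕜 : Type*} [RCLike 𝕜]
    (r s t : ℕ → 𝕜) (hr : ∀ n, r n ≠ 0) (hs : s 0 ≠ 0) (ht : ∀ n, t n ≠ 0)
    (u v : 𝕜) (hu : u ≠ 0) (hv : v ≠ 0)
    (p : ℕ → ℝ) (hp : ∀ k, 0 < p k) (hpb : BddAbove (Set.range p)) :
    ((∀ k, 1 < p k) →
      GenMeans.gammaDual (GenMeans.meanBandSpace r s t u v (GenMeans.maddoxL p))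
        = GenMeans.Gamma5 r s t u v p) ∧
    ((∀ k, p k ≤ 1) →
      GenMeans.gammaDual (GenMeans.meanBandSpace r s t u v (GenMeans.maddoxL p))
        = GenMeans.Gamma4 r s t u v p) ∧
    GenMeans.gammaDual (GenMeans.meanBandSpace r s t u v (GenMeans.maddoxC0 p))
      = GenMeans.Gamma1 r s t u v p ∧
    GenMeans.gammaDual (GenMeans.meanBandSpace r s t u v (GenMeans.maddoxC p))
      = GenMeans.Gamma1 r s t u v p ∩ GenMeans.Gamma2 r s t u v ∧
    GenMeans.gammaDual (GenMeans.meanBandSpace r s t u v (GenMeans.maddoxLInfty p))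
      = GenMeans.Gamma3 r s t u v p := by
  have hE : ∀ (a : ℕ → 𝕜) (n k : ℕ), n < k → GenMeans.eMatrix r s t u v a n k = 0 :=
    fun a n k => GenMeans.eMatrix_eq_zero_of_lt
  have h1 : ∀ a, GenMeans.MapsToBounded (GenMeans.eMatrix r s t u v a) (GenMeans.maddoxC0 p)
      ↔ a ∈ GenMeans.Gamma1 r s t u v p := by
    intro a
    rw [GenMeans.mapsToBounded_maddoxC0_iff (hE a) hp]
    refine exists_congr fun L => and_congr_right fun _ => ?_
    rw [GenMeans.iSup_tsum_ofReal_lt_top_iff (fun n k => by positivity)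
      fun n k hk => by rw [hE a n k hk, norm_zero, zero_mul]]
  refine ⟨fun hp1 => ?_, fun hp1 => ?_, ?_, ?_, ?_⟩ <;> ext a <;>
    rw [GenMeans.mem_gammaDual_meanBandSpace_iff hr hs ht hu]
  · rw [GenMeans.mapsToBounded_maddoxL_iff_of_one_lt (hE a) hp1]
    refine exists_congr fun L => and_congr_right fun _ => ?_
    rw [GenMeans.iSup_tsum_ofReal_lt_top_iff (fun n k => by positivity)]
    intro n k hk
    have hq : p k / (p k - 1) ≠ 0 := (div_pos (hp k) (sub_pos.2 (hp1 k))).ne'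
    rw [hE a n k hk, zero_mul, norm_zero, Real.zero_rpow hq]
  · rw [GenMeans.mapsToBounded_maddoxL_iff_of_le_one (hE a) hp hp1]
    refine exists_congr fun L => and_congr_right fun _ => ?_
    rw [iSup_prod' (fun n k => ENNReal.ofReal
      (‖GenMeans.eMatrix r s t u v a n k * (L : 𝕜)⁻¹‖ ^ p k)),
      GenMeans.iSup_ofReal_lt_top_iff]
    simp only [Prod.forall]
  · exact h1 a
  · rw [GenMeans.mapsToBounded_maddoxC_iff hp, h1, Set.mem_inter_iff]
    refine and_congr_right fun _ => ?_
    have : ∀ n, ‖∑' k, GenMeans.eMatrix r s t u v a n k‖ₑ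
        = ENNReal.ofReal ‖∑ k ∈ range (n + 1), GenMeans.eMatrix r s t u v a n k‖ := by
      intro n
      rw [ofReal_norm, tsum_eq_sum (s := range (n + 1)) fun k hk => hE a n k (by simpa using hk)]
    simp only [GenMeans.Gamma2, Set.mem_ofPred_eq, this, GenMeans.iSup_ofReal_lt_top_iff]
    exact exists_congr fun M => Set.forall_mem_range
  · rw [GenMeans.mapsToBounded_maddoxLInfty_iff (hE a) hp]
    refine forall_congr' fun L => imp_congr_right fun _ => ?_
    rw [GenMeans.iSup_tsum_ofReal_lt_top_iff (fun n k => by positivity)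
      fun n k hk => by rw [hE a n k hk, norm_zero, zero_mul]]
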